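/- A convergence $\xi$ on a set $X$ is a relation "$x\in\lim_\xi\mathcal F$" between (proper) filters $\mathcal F$ on $X$ and points $x\in X$ such that $\lim_\xi\mathcal F\subset\lim_\xi\mathcal G$ whenever $\mathcal F\subset\mathcal G$, and $x\in\lim_\xi\{x\}^{\uparrow}$ for every $x\in X$, where $\{x\}^\uparrow$ is the principal filter of $x$. It is Hausdorff if every filter has at most one limit. For convergences on $X$ write $\xi\ge\theta$ ($\xi$ is finer than $\theta$, $\theta$ is coarser than $\xi$) if $\lim_\xi\mathcal F\subset\lim_\theta\mathcal F$ for every filter $\mathcal F$. A topology is identified with the convergence in which $x\in\lim\mathcal F$ iff $\mathcal F$ contains every neighborhood of $x$. - $\operatorname{T}\xi$ denotes the topology whose open sets are the $O\subset X$ such that $O\in\mathcal F$ whenever $\lim_\xi\mathcal F\cap O\ne\emptyset$. - $\xi$ is a pretopology if, for every $x\in X$, the intersection of all filters converging to $x$ converges to $x$. - $\operatorname{I}_1\xi$ is the convergence with $x\in\lim_{\operatorname{I}_1\xi}\mathcal F$ iff $x\in\lim_\xi\mathcal H$ for some filter $\mathcal H\subset\mathcal F$ with a countable filter-base; $\xi$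 has countable character if $\xi=\operatorname{I}_1\xi$. - For convergences $\xi$ on $X$ and $\tau$ on $Y$, $\xi\times\tau$ is the coarsest convergence on $X\times Y$ making both projections continuous: $(x,y)\in\lim_{\xi\times\tau}\mathcal F$ iff $x\in\lim_\xi p_X[\mathcal F]$ and $y\in\lim_\tau p_Y[\mathcal F]$, where $p_X[\mathcal F]$, $p_Y[\mathcal F]$ are the image filters under the projections. - $\operatorname{Epi}_{\operatorname{I}_1}\xi$ is the coarsest convergence $\theta$ on $X$ such that $\operatorname{T}(\xi\times\tau)=\operatorname{T}(\theta\times\tau)$ for every convergence $\tau$ (on any set) of countable character. A convergence $\xi$ is *countably $\operatorname{S}_0$-characterized* if there is a pretopology $\sigma$ of countable character on $X$ with $\sigma\ge\xi\ge\operatorname{T}\sigma$; it is *strongly countably $\operatorname{S}_0$-characterized* if there is a pretopology $\sigma$ of countable character on $X$ with $\sigma\ge\xi\ge\operatorname{Epi}_{\operatorname{I}_1}\sigma$; and it is *strongly sequential* if $\xi\ge\operatorname{Epi}_{\operatorname{I}_1}\operatorname{I}_1\xi$. **Proposition.** A Hausdorff convergence $\xi$ is strongly countably $\operatorname{S}_0$-characterized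 if and only if it is countably $\operatorname{S}_0$-characterized and strongly sequential. -/

import Mathlib

universe u v

/-- A convergence on the set `X`: a relation `ξ.lim F x` ("`F` converges to `x`") between filters
and points. Mathlib orders filters by reverse inclusion, so `G ≤ F` below says that `G` contains
every element of `F`. The degenerate filter `⊥` is allowed as an argument, but the two axioms force
it to converge to every point, so that a convergence is determined by its values on proper
filters. -/
@[ext]
structure Convergence (X : Type u) where
  lim : Filter X → X → Prop
  lim_mono : ∀ {F G : Filter X} {x : X}, G ≤ F → lim F x → lim G x
  lim_pure : ∀ x : X, lim (pure x) x

namespace Convergence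

variable {X : Type u} {Y : Type v}

/-- `θ ≤ ξ` means that `ξ` is finer than `θ`: `lim_ξ F ⊆ lim_θ F` for every filter `F`. -/
instance : PartialOrder (Convergence X) where
  le θ ξ := ∀ (F : Filter X) (x : X), ξ.lim F x → θ.lim F x
  le_refl _ _ _ h := h
  le_trans _ _ _ h₁ h₂ F x h := h₁ F x (h₂ F x h)
  le_antisymm a b h₁ h₂ := by
    ext F x
    exact ⟨h₂ F x, h₁ F x⟩

/-- Every proper filter has at most one limit. -/
def IsHausdorff (ξ : Convergence X) : Prop :=
  ∀ (F : Filter X) [F.NeBot] (x y : X), ξ.lim F x → ξ.lim F y → x = y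

/-- The convergence induced by a topology. -/
def ofTopology (t : TopologicalSpace X) : Convergence X where
  lim F x := F ≤ @nhds X t x
  lim_mono hGF hF := hGF.trans hF
  lim_pure x := @pure_le_nhds X t x

/-- `O` is `ξ`-open: it belongs to every filter that converges to one of its points. -/
def IsOpenSet (ξ : Convergence X) (O : Set X) : Prop :=
  ∀ x ∈ O, ∀ F : Filter X, ξ.lim F x → O ∈ F

/-- The topology of all `ξ`-open sets. -/
@[reducible]
def openTopology (ξ : Convergence X) : TopologicalSpace X where
  IsOpen := ξ.IsOpenSet
  isOpen_univ _ _ _ _ := Filter.univ_mem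
  isOpen_inter _ _ hs ht x hx F hF :=
    Filter.inter_mem (hs x hx.1 F hF) (ht x hx.2 F hF)
  isOpen_sUnion _ hS x hx F hF := by
    obtain ⟨s, hs, hxs⟩ := hx
    exact Filter.mem_of_superset (hS s hs x hxs F hF) (Set.subset_sUnion_of_mem hs)

/-- The topologizer `T`: the topological modification of `ξ`, seen as a convergence. -/
def T (ξ : Convergence X) : Convergence X := ofTopology ξ.openTopology

/-- The vicinity filter of `x`: the intersection of all filters that converge to `x`
(a supremum in Mathlib's order on filters). -/
def vicinity (ξ : Convergence X) (x : X) : Filter X :=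
  ⨆ F ∈ {F : Filter X | ξ.lim F x}, F

/-- `ξ` is a pretopology: every vicinity filter converges. -/
def IsPretopology (ξ : Convergence X) : Prop :=
  ∀ x : X, ξ.lim (ξ.vicinity x) x

/-- The modification of countable character `I₁ ξ`: `F` converges to `x` for `I₁ ξ` iff `F`
contains a countably based filter that converges to `x` for `ξ`. -/
def I₁ (ξ : Convergence X) : Convergence X where
  lim F x := ∃ H : Filter X, H.IsCountablyGenerated ∧ F ≤ H ∧ ξ.lim H x
  lim_mono := by
    rintro F G x hGF ⟨H, hH, hFH, hx⟩
    exact ⟨H, hH, hGF.trans hFH, hx⟩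
  lim_pure x := ⟨pure x, inferInstance, le_rfl, ξ.lim_pure x⟩

/-- `ξ` has countable character: it is a fixed point of `I₁`, that is, every convergent filter
contains a countably based filter with the same limit. -/
def HasCountableCharacter (ξ : Convergence X) : Prop := ξ = ξ.I₁

/-- The product convergence: the coarsest one making both projections continuous. -/
def prod (ξ : Convergence X) (τ : Convergence Y) : Convergence (X × Y) where
  lim F p := ξ.lim (F.map Prod.fst) p.1 ∧ τ.lim (F.map Prod.snd) p.2
  lim_mono hGF h :=
    ⟨ξ.lim_mono (Filter.map_mono hGF) h.1, τ.lim_mono (Filter.map_mono hGF) h.2⟩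
  lim_pure p := by
    simp only [Filter.map_pure]
    exact ⟨ξ.lim_pure p.1, τ.lim_pure p.2⟩

/-- The convergences `θ` on `X` such that `T (ξ × τ) = T (θ × τ)` for every convergence `τ` of
countable character. (Letting `τ` live on sets of other universes does not change the class: a set
`O ⊆ X × Y` is the preimage of the membership relation in `X × Set X` under
`(x, y) ↦ (x, {x' | (x', y) ∈ O})`, so that `τ` can be replaced by its image on `Set X`.) -/
def EpiClass (ξ : Convergence X) : Set (Convergence X) :=
  {θ | ∀ (Y : Type u) (τ : Convergence Y), τ.HasCountableCharacter →
    (ξ.prod τ).T = (θ.prod τ).T}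

/-- The reflector `Epi_{I₁}`: the coarsest convergence in `EpiClass ξ`, see `isLeast_epiI₁`.
It is built as the infimum of the class, whose convergent filters are those that converge for
some member. -/
def EpiI₁ (ξ : Convergence X) : Convergence X where
  lim F x := ∃ θ ∈ ξ.EpiClass, θ.lim F x
  lim_mono := by
    rintro F G x hGF ⟨θ, hθ, hx⟩
    exact ⟨θ, hθ, θ.lim_mono hGF hx⟩
  lim_pure x := ⟨ξ, fun _ _ _ => rfl, ξ.lim_pure x⟩

theorem isOpenSet_of_T_eq {ξ θ : Convergence X} (h : ξ.T = θ.T) {O : Set X}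
    (hO : ξ.IsOpenSet O) : θ.IsOpenSet O := by
  intro x hx F hF
  have h1 : θ.T.lim F x := by
    intro s hs
    obtain ⟨U, hUs, hU, hxU⟩ := (@mem_nhds_iff X θ.openTopology x s).1 hs
    exact Filter.mem_of_superset (hU x hxU F hF) hUs
  rw [← h] at h1
  exact h1 (@IsOpen.mem_nhds X ξ.openTopology x O hO hx)

theorem T_eq_of_isOpenSet_iff {ξ θ : Convergence X}
    (h : ∀ O : Set X, ξ.IsOpenSet O ↔ θ.IsOpenSet O) : ξ.T = θ.T := by
  have : ξ.openTopology = θ.openTopology := TopologicalSpace.ext (funext fun O => propext (h O))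
  rw [T, T, this]

/-- `EpiI₁ ξ` is the coarsest convergence in `EpiClass ξ`. -/
theorem isLeast_epiI₁ (ξ : Convergence X) : IsLeast ξ.EpiClass ξ.EpiI₁ := by
  refine ⟨fun Y τ hτ => T_eq_of_isOpenSet_iff fun O => ⟨?_, ?_⟩, fun θ hθ F x hx => ⟨θ, hθ, hx⟩⟩
  · rintro hO p hp F ⟨⟨θ, hθ, h1⟩, h2⟩
    exact isOpenSet_of_T_eq (hθ Y τ hτ) hO p hp F ⟨h1, h2⟩
  · rintro hO p hp F ⟨h1, h2⟩
    exact hO p hp F ⟨⟨ξ, fun _ _ _ => rfl, h1⟩, h2⟩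

/-- `ξ` is countably `S₀`-characterized (has countable `S₀`-character). -/
def IsCountablyS₀Characterized (ξ : Convergence X) : Prop :=
  ∃ σ : Convergence X, σ.IsPretopology ∧ σ.HasCountableCharacter ∧ σ ≥ ξ ∧ ξ ≥ σ.T

/-- `ξ` is strongly countably `S₀`-characterized. -/
def IsStronglyCountablyS₀Characterized (ξ : Convergence X) : Prop :=
  ∃ σ : Convergence X, σ.IsPretopology ∧ σ.HasCountableCharacter ∧ σ ≥ ξ ∧ ξ ≥ σ.EpiI₁

/-- `ξ` is strongly sequential. -/
def IsStronglySequential (ξ : Convergence X) : Prop := ξ ≥ ξ.I₁.EpiI₁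

end Convergence

namespace Convergence

variable {X : Type u} {Y : Type v}

/-! Strong characterization implies the other two properties by monotonicity alone: `T σ ≤ EpiI₁ σ`,
and `ξ ≤ σ = I₁ σ` gives `I₁ ξ ≤ σ`, hence `EpiI₁ (I₁ ξ) ≤ EpiI₁ σ ≤ ξ`. The converse rests on
rigidity: for Hausdorff `ξ`, the only possible `σ` is `I₁ ξ` (`I₁_eq_of_isHausdorff`), so strong
sequentiality is literally `ξ ≥ EpiI₁ σ`. The core is `IsHausdorff.le_vicinity`. If a countably
based filter converging to `x` for `ξ` missed a vicinity `V` of `x`, some sequence finer than it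
would stay outside `V`. Its range would be `σ`-closed because `ξ` is Hausdorff, and would not
contain `x`, contradicting `ξ ≥ T σ`. -/

theorem IsOpenSet.of_le {ξ θ : Convergence X} (h : θ ≤ ξ) {O : Set X} (hO : θ.IsOpenSet O) :
    ξ.IsOpenSet O :=
  fun x hx F hF => hO x hx F (h F x hF)

theorem prod_mono_left {ξ θ : Convergence X} (h : θ ≤ ξ) (τ : Convergence Y) :
    θ.prod τ ≤ ξ.prod τ :=
  fun _ _ hF => ⟨h _ _ hF.1, hF.2⟩

theorem I₁_mono {ξ θ : Convergence X} (h : θ ≤ ξ) : θ.I₁ ≤ ξ.I₁ := by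
  rintro F x ⟨H, hH, hFH, hx⟩
  exact ⟨H, hH, hFH, h H x hx⟩

theorem T_lim_iff {ξ : Convergence X} {F : Filter X} {x : X} :
    ξ.T.lim F x ↔ ∀ O, ξ.IsOpenSet O → x ∈ O → O ∈ F := by
  constructor
  · intro h O hO hx
    exact h (@IsOpen.mem_nhds X ξ.openTopology x O hO hx)
  · intro h s hs
    obtain ⟨U, hUs, hU, hxU⟩ := (@mem_nhds_iff X ξ.openTopology x s).1 hs
    exact Filter.mem_of_superset (h U hU hxU) hUs

/-- The infimum of two convergences: a filter converges iff it does so for one of them. -/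
def inf (ξ θ : Convergence X) : Convergence X where
  lim F x := ξ.lim F x ∨ θ.lim F x
  lim_mono hGF := Or.imp (ξ.lim_mono hGF) (θ.lim_mono hGF)
  lim_pure x := Or.inl (ξ.lim_pure x)

/-- If `η` is in the class of `ξ`, then `θ.inf η` is in the class of `θ`: a set open for `θ × τ` is
open for the finer `ξ × τ`, hence for `η × τ`. -/
theorem EpiI₁_mono {ξ θ : Convergence X} (h : θ ≤ ξ) : θ.EpiI₁ ≤ ξ.EpiI₁ := by
  rintro F x ⟨η, hη, hF⟩
  refine ⟨θ.inf η, fun Y τ hτ => T_eq_of_isOpenSet_iff fun O => ⟨fun hO => ?_, fun hO => ?_⟩,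
    Or.inr hF⟩
  · rintro p hp G ⟨hG₁ | hG₁, hG₂⟩
    · exact hO p hp G ⟨hG₁, hG₂⟩
    · exact isOpenSet_of_T_eq (hη Y τ hτ) (hO.of_le (prod_mono_left h τ)) p hp G ⟨hG₁, hG₂⟩
  · exact hO.of_le (prod_mono_left (fun _ _ => Or.inl) τ)

/-- The convergence in which every filter converges to every point. -/
def chaotic (Y : Type v) : Convergence Y where
  lim _ _ := True
  lim_mono _ h := h
  lim_pure _ := trivial

theorem chaotic_hasCountableCharacter (Y : Type v) : (chaotic Y).HasCountableCharacter := by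
  ext F y
  exact ⟨fun _ => ⟨⊤, inferInstance, le_top, trivial⟩, fun _ => trivial⟩

/-- Taking `τ` on a one-point set, the products have the same open sets as their first factors. -/
theorem T_le_EpiI₁ (ξ : Convergence X) : ξ.T ≤ ξ.EpiI₁ := by
  rintro F x ⟨θ, hθ, hF⟩
  refine T_lim_iff.2 fun O hO hx => ?_
  have hO' : (ξ.prod (chaotic PUnit.{u + 1})).IsOpenSet (Prod.fst ⁻¹' O) :=
    fun p hp G hG => hO p.1 hp _ hG.1
  have h := isOpenSet_of_T_eq (hθ _ _ (chaotic_hasCountableCharacter _)) hO' (x, PUnit.unit) hx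
    (F.map fun a => (a, PUnit.unit)) ⟨by simpa [Filter.map_map, Function.comp_def] using hF, trivial⟩
  exact h

theorem lim_le_vicinity {ξ : Convergence X} {F : Filter X} {x : X} (h : ξ.lim F x) :
    F ≤ ξ.vicinity x :=
  le_iSup₂ (f := fun (F : Filter X) (_ : F ∈ {F : Filter X | ξ.lim F x}) => F) F h

/-- If `σ ≥ ξ ≥ T σ` and `ξ` is Hausdorff, then the countably based filters that converge for `ξ`
are finer than the vicinity filters of `σ`. -/
theorem IsHausdorff.le_vicinity {ξ σ : Convergence X} (hξ : ξ.IsHausdorff) (hσξ : ξ ≤ σ)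
    (hξσ : σ.T ≤ ξ) {F : Filter X} [F.IsCountablyGenerated] {x : X} (hF : ξ.lim F x) :
    F ≤ σ.vicinity x := by
  intro V hV
  by_contra hVF
  have : (F ⊓ Filter.principal Vᶜ).NeBot := by
    rw [Filter.neBot_iff]
    exact fun h => hVF (by simpa using Filter.mem_iff_inf_principal_compl.2 h)
  -- This is where the countable base of `F` is used.
  obtain ⟨s, hs⟩ := Filter.exists_seq_tendsto (F ⊓ Filter.principal Vᶜ)
  obtain ⟨hsF, hsV⟩ := Filter.tendsto_inf.1 hs
  have hsV : ∀ᶠ n in Filter.atTop, s n ∈ Vᶜ := Filter.tendsto_principal.1 hsV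
  obtain ⟨N, hN⟩ := Filter.eventually_atTop.1 hsV
  set A : Set X := s '' Set.Ici N
  have hAV : A ⊆ Vᶜ := by
    rintro _ ⟨n, hn, rfl⟩
    exact hN n hn
  have hxV : x ∈ V := lim_le_vicinity (σ.lim_pure x) hV
  -- Let `H` converge to `z ∉ A` for `σ`. Either `H` meshes with the sequence, or it contains a set
  -- disjoint from a tail of it.
  have hA : σ.IsOpenSet Aᶜ := by
    intro z hz H hH
    by_cases hne : (H ⊓ Filter.map s Filter.atTop).NeBot
    · exfalso
      -- The common refinement converges to both `z` and `x`. Then `V ∈ H`, although the sequence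
      -- avoids `V`.
      obtain rfl : z = x := hξ _ z x (ξ.lim_mono inf_le_left (hσξ H z hH))
        (ξ.lim_mono (inf_le_right.trans hsF) hF)
      have h₁ : V ∈ H := lim_le_vicinity hH hV
      have h₂ : Vᶜ ∈ Filter.map s Filter.atTop := hsV
      exact hne.ne (Filter.inf_eq_bot_iff.2 ⟨V, h₁, Vᶜ, h₂, Set.inter_compl_self V⟩)
    · rw [Filter.not_neBot, Filter.inf_eq_bot_iff] at hne
      obtain ⟨U, hU, W, hW, hUW⟩ := hne
      obtain ⟨M, hM⟩ := Filter.eventually_atTop.1 (Filter.mem_map.1 hW)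
      -- The finitely many remaining terms are removed one by one: if `H` does not contain `{s n}ᶜ`,
      -- then `pure (s n)` refines `H` and converges to `z`, so `s n = z`, contrary to `z ∉ A`.
      have hfin : ∀ n ∈ Set.Ico N M, {s n}ᶜ ∈ H := by
        intro n hn
        by_contra hnH
        have hle : pure (s n) ≤ H := by
          intro B hB
          by_contra hnB
          exact hnH (Filter.mem_of_superset hB fun b hb hbn => hnB (hbn ▸ hb))
        have : s n = z := hξ (pure (s n)) _ _ (ξ.lim_pure _)
          (ξ.lim_mono hle (hσξ H z hH))
        exact hz ⟨n, hn.1, this⟩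
      filter_upwards [hU, (Filter.biInter_mem (Set.finite_Ico N M)).2 hfin] with a haU ha
      rintro ⟨n, hn, rfl⟩
      by_cases hnM : n < M
      · exact Set.mem_iInter₂.1 ha n ⟨hn, hnM⟩ rfl
      · exact (hUW.subset ⟨haU, hM n (not_lt.1 hnM)⟩ : s n ∈ (∅ : Set X))
  -- `F` converges to `x ∈ Aᶜ` for `T σ`, so the sequence is eventually outside its own range `A`.
  have hmem : Aᶜ ∈ Filter.map s Filter.atTop :=
    hsF (T_lim_iff.1 (hξσ F x hF) _ hA fun hxA => hAV hxA hxV)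
  have hev : ∀ᶠ n in Filter.atTop, s n ∈ Aᶜ := hmem
  obtain ⟨n, hn, hnN⟩ := (hev.and (Filter.eventually_ge_atTop N)).exists
  exact hn ⟨n, hnN, rfl⟩

theorem I₁_eq_of_isHausdorff {X : Type u} {ξ σ : Convergence X} (hξ : ξ.IsHausdorff)
    (hσ : σ.IsPretopology) (hσc : σ.HasCountableCharacter) (hσξ : ξ ≤ σ) (hξσ : σ.T ≤ ξ) :
    ξ.I₁ = σ := by
  refine le_antisymm ?_ ?_
  · rw [hσc]
    exact I₁_mono hσξ
  · rintro F x ⟨H, hH, hFH, hx⟩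
    -- As `σ` is a pretopology, refining its vicinity filter at `x` suffices for convergence to `x`.
    exact σ.lim_mono (hFH.trans (hξ.le_vicinity hσξ hξσ hx)) (hσ x)

end Convergence

theorem proposition5p3 {X : Type u} (ξ : Convergence X) (hξ : ξ.IsHausdorff) :
    ξ.IsStronglyCountablyS₀Characterized ↔
      ξ.IsCountablyS₀Characterized ∧ ξ.IsStronglySequential := by
  constructor
  · rintro ⟨σ, hσ, hσc, hσξ, hξσ⟩
    refine ⟨⟨σ, hσ, hσc, hσξ, σ.T_le_EpiI₁.trans hξσ⟩, ?_⟩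
    have h : ξ.I₁ ≤ σ := by
      rw [hσc]
      exact Convergence.I₁_mono hσξ
    exact (Convergence.EpiI₁_mono h).trans hξσ
  · rintro ⟨⟨σ, hσ, hσc, hσξ, hξσ⟩, hseq⟩
    refine ⟨σ, hσ, hσc, hσξ, ?_⟩
    rw [← Convergence.I₁_eq_of_isHausdorff hξ hσ hσc hσξ hξσ]
    exact hseq
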